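/- Write $[r]=\{0,\dots,r-1\}$. Let $U$ be a finite set, let $\mathcal F$ be an arbitrary $2$-universal hash class of functions $U\to[\ell]$ (a nonempty set of functions with $\Pr_{g\in\mathcal F}(g(x)=g(y))\le 2/\ell$ for all $x\neq y$), and let $\mathcal H$ be an arbitrary $2$-wise independent hash class of functions $U\to[m]$ (a nonempty set of functions with $\Pr_{f\in\mathcal H}(f(x)=a\wedge f(y)=b)=1/m^2$ for all $x\ne y$ and $a,b\in[m]$). The class $\mathcal Z=\mathcal Z^{c,d}_{\ell,m}$ consists of all sequences $\vec h=(h_1,\dots,h_d)$, $$h_i(x)=\Bigl(f_i(x)+\sum_{1\le j\le c} z^{(i)}[j,g_j(x)]\Bigr)\bmod m ,$$ with $f_1,\dots,f_d\in\mathcal H$, $g_1,\dots,g_c\in\mathcal F$ and tables $z^{(1)},\dots,z^{(d)}\in[m]^{\{1,\dots,c\}\times[\ell]}$; choosing $\vec h$ at random from $\mathcal Z$ means choosing all the $f_i$, $g_j$, $z^{(i)}$ independently and uniformly. Khosla's algorithm uses tables $T_1,\dots,T_d$ of size $m$, initially empty, with labels $l(j,i)\in\mathbb N$, initially $0$. To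 insert a key $x$, choose $j\in\{1,\dots,d\}$ minimizing $l(j,h_j(x))$ (ties are broken arbitrarily), write $x$ into $T_j[h_j(x)]$, and set $l(j,h_j(x))\leftarrow\min\{l(j',h_{j'}(x))\mid j'\ne j\}+1$. If the cell was free, the insertion is finished; otherwise insert the key that resided there before in the same way. When $n$ keys are to be inserted, the algorithm gives up (the insertion fails) as soon as some label has reached $n+1$. **Theorem.** Let $\varepsilon>0$, $0<\delta<1$, and integers $d\ge 3$ and $c\ge 2/\delta$ be given. There are constants $C,K$, depending only on $\varepsilon,\delta,d,c$, such that the following holds for all $n\ge 1$, all integers $m\ge(1+\varepsilon)(d-1)n$, $\ell=n^\delta$ (rounded down or up to an integer), all $U$, $\mathcal F$, $\mathcal H$ as above, and all $S\subseteq U$ with $|S|=n$. Choose $\vec h\in\mathcal Z^{c,d}_{\ell,m}$ at random. Then with probability at least $1-C/n$, for every order in which the keys of $S$ are inserted one after the other by Khosla's algorithm, and for every way of breaking ties, (i) all key insertions are successful (in particular, they terminate), and (ii) the labels satisfy $\max\{l(j,i)\mid 1\le j\le d,\ i\in[m]\}\le K\log n$ throughout the whole process, in particular at the end. -/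

import Mathlib

namespace KhoslaCuckoo

open Classical in
/-- Probability of the event `E` when an element of the finite set `A` is chosen uniformly at
random. -/
noncomputable def unifProb {Ω : Type*} (A : Finset Ω) (E : Ω → Prop) : ℝ :=
  ((A.filter E).card : ℝ) / (A.card : ℝ)

/-- `F` is a 2-universal hash class of functions from `U` to `[r]`. -/
structure IsTwoUniversal {U : Type*} {r : ℕ} (F : Finset (U → Fin r)) : Prop where
  nonempty : F.Nonempty
  collision : ∀ x y : U, x ≠ y → unifProb F (fun g => g x = g y) ≤ 2 / (r : ℝ)

/-- `H` is a 2-wise independent hash class of functions from `U` to `[r]`. -/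
structure IsTwoWiseIndependent {U : Type*} {r : ℕ} (H : Finset (U → Fin r)) : Prop where
  nonempty : H.Nonempty
  indep : ∀ x y : U, x ≠ y → ∀ a b : Fin r,
    unifProb H (fun f => f x = a ∧ f y = b) = 1 / (r : ℝ) ^ 2

/-- The components `(f₁, …, f_d)`, `(g₁, …, g_c)` and `(z⁽¹⁾, …, z⁽ᵈ⁾)` of a hash function
sequence, where `z⁽ⁱ⁾` is a `c × ℓ` table with entries in `[m]`. -/
abbrev HashParts (U : Type*) (c d ℓ m : ℕ) : Type _ :=
  (Fin d → U → Fin m) × (Fin c → U → Fin ℓ) × (Fin d → Fin c → Fin ℓ → Fin m)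

/-- `h_i(x) = (f_i(x) + ∑_j z⁽ⁱ⁾[j, g_j(x)]) mod m`. -/
def HashParts.hash {U : Type*} {c d ℓ m : ℕ} (ω : HashParts U c d ℓ m) (i : Fin d) (x : U) :
    Fin m :=
  ⟨((ω.1 i x : ℕ) + ∑ j : Fin c, (ω.2.2 i j (ω.2.1 j x) : ℕ)) % m, Nat.mod_lt _ (ω.1 i x).pos⟩

/-- The hash class `𝒵` built from the classes `F` (for the `g_j`) and `H` (for the `f_i`); the
tables range over all tables. -/
def hashClass {U : Type*} (c d : ℕ) {ℓ m : ℕ} (F : Finset (U → Fin ℓ)) (H : Finset (U → Fin m)) :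
    Finset (HashParts U c d ℓ m) :=
  Fintype.piFinset (fun _ : Fin d => H) ×ˢ
    (Fintype.piFinset (fun _ : Fin c => F) ×ˢ Finset.univ)

/-- Current state of the hash table during the insertion of a sequence of keys.  The cell `(j, i)`
is the cell `T_j[i]`. -/
structure State (U : Type*) (d m : ℕ) where
  /-- contents of the cells (`none` means free) -/
  table : Fin d × Fin m → Option U
  /-- the labels `l(j, i)` -/
  label : Fin d × Fin m → ℕ
  /-- the keys that still have to be placed; the head is the key that is placed next -/
  pending : List U

/-- All cells are free, all labels are zero, and the keys in the list `L` are to be inserted in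
the order of the list. -/
def State.init {U : Type*} (d m : ℕ) (L : List U) : State U d m where
  table := fun _ => none
  label := fun _ => 0
  pending := L

/-- The maximum of all labels. -/
def State.maxLabel {U : Type*} {d m : ℕ} (s : State U d m) : ℕ :=
  Finset.univ.sup s.label

/-- The table index `j` minimizes `l(j, h_j(x))`. -/
def IsArgmin {U : Type*} {d m : ℕ} (h : Fin d → U → Fin m) (s : State U d m) (x : U)
    (j : Fin d) : Prop :=
  ∀ j' : Fin d, s.label (j, h j x) ≤ s.label (j', h j' x)

/-- Write `x` into `T_j[h_j(x)]`, set
`l(j, h_j(x)) ← min {l(j', h_{j'}(x)) | j' ≠ j} + 1`, and go on with the key that resided in this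
cell, or, if the cell was free, with the next key in `rest`. -/
noncomputable def State.move {U : Type*} {d m : ℕ} (h : Fin d → U → Fin m) (s : State U d m)
    (x : U) (rest : List U) (j : Fin d) : State U d m where
  table := Function.update s.table (j, h j x) (some x)
  label := Function.update s.label (j, h j x)
    (sInf {k : ℕ | ∃ j' : Fin d, j' ≠ j ∧ k = s.label (j', h j' x)} + 1)
  pending := match s.table (j, h j x) with
    | none => rest
    | some y => y :: rest

/-- One move of Khosla's algorithm (ties in the choice of `j` are broken arbitrarily).  The
algorithm gives up, i.e., makes no further move, as soon as there is a label of size at least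
`n + 1`. -/
def Step {U : Type*} {d m : ℕ} (h : Fin d → U → Fin m) (n : ℕ) (s t : State U d m) : Prop :=
  s.maxLabel ≤ n ∧
    ∃ (x : U) (rest : List U) (j : Fin d),
      s.pending = x :: rest ∧ IsArgmin h s x j ∧ t = s.move h x rest j

/-- `s` can occur when the keys in `L` are inserted one after the other. -/
def Reachable {U : Type*} {d m : ℕ} (h : Fin d → U → Fin m) (n : ℕ) (L : List U)
    (s : State U d m) : Prop :=
  Relation.ReflTransGen (Step h n) (State.init d m L) s

/-- Every run of the algorithm on the key sequence `L` (whatever the tie-breaking) terminates, and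
when it terminates all keys have been placed and no label has reached `n + 1`. -/
def AllInsertionsSucceed {U : Type*} {d m : ℕ} (h : Fin d → U → Fin m) (n : ℕ) (L : List U) :
    Prop :=
  (¬ ∃ run : ℕ → State U d m, run 0 = State.init d m L ∧ ∀ k, Step h n (run k) (run (k + 1))) ∧
    ∀ s : State U d m, Reachable h n L s → (∀ t, ¬ Step h n s t) →
      s.pending = [] ∧ s.maxLabel ≤ n

/-- `L` lists the elements of `S`, each exactly once. -/
def IsOrdering {U : Type*} (S : Finset U) (L : List U) : Prop :=
  L.Nodup ∧ ∀ x, x ∈ L ↔ x ∈ S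

end KhoslaCuckoo

namespace KhoslaCuckoo

/-! ### Deterministic analysis: large labels force path patterns -/

variable {U : Type*} {d m : ℕ}

/-- Consecutive table indices are different. -/
def Alternating {s : ℕ} (j : Fin (s + 1) → Fin d) : Prop :=
  ∀ i : Fin s, j i.succ ≠ j i.castSucc

/-- Consecutive keys share a cell of the prescribed table. -/
def Linked {s : ℕ} (h : Fin d → U → Fin m) (x : Fin (s + 1) → U) (j : Fin (s + 1) → Fin d) :
    Prop :=
  ∀ i : Fin s, h (j i.succ) (x i.succ) = h (j i.succ) (x i.castSucc)

/-- Two further cells of the last key are shared with earlier keys. -/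
def ClosesUp {s : ℕ} (h : Fin d → U → Fin m) (x : Fin (s + 1) → U) (j : Fin (s + 1) → Fin d)
    (a b : Fin s) (k k' : Fin d) : Prop :=
  k ≠ k' ∧ k ≠ j (Fin.last s) ∧ k' ≠ j (Fin.last s) ∧
    h k (x (Fin.last s)) = h k (x a.castSucc) ∧ h k' (x (Fin.last s)) = h k' (x b.castSucc)

/-- A self-avoiding path of `t + 1` keys from `S`. -/
def HasPath (h : Fin d → U → Fin m) (S : Finset U) (t : ℕ) : Prop :=
  ∃ (x : Fin (t + 1) → U) (j : Fin (t + 1) → Fin d), x.Injective ∧ (∀ i, x i ∈ S) ∧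
    Alternating j ∧ Linked h x j

/-- A self-avoiding path of `s + 1` keys from `S` with two additional coincidences at its end. -/
def HasClosedPath (h : Fin d → U → Fin m) (S : Finset U) (s : ℕ) : Prop :=
  ∃ (x : Fin (s + 1) → U) (j : Fin (s + 1) → Fin d), x.Injective ∧ (∀ i, x i ∈ S) ∧
    Alternating j ∧ Linked h x j ∧ ∃ a b k k', ClosesUp h x j a b k k'

/-- The properties maintained by Khosla's algorithm when the keys of `S` are inserted. -/
structure Invariant (h : Fin d → U → Fin m) (S : Finset U) (s : State U d m) : Prop where
  free : ∀ v, s.table v = none → s.label v = 0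
  cell : ∀ v x, s.table v = some x → v.2 = h v.1 x
  mem : ∀ v x, s.table v = some x → x ∈ S
  label_le : ∀ v x, s.table v = some x → ∀ j, j ≠ v.1 → s.label v ≤ s.label (j, h j x) + 1
  inj : ∀ v w x, s.table v = some x → s.table w = some x → v = w
  nodup : s.pending.Nodup
  pending_mem : ∀ x ∈ s.pending, x ∈ S
  pending_not_mem : ∀ x ∈ s.pending, ∀ v, s.table v ≠ some x

theorem Invariant.init (h : Fin d → U → Fin m) (S : Finset U) {L : List U}
    (hL : IsOrdering S L) : Invariant h S (State.init d m L) where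
  free _ _ := rfl
  cell v x hx := by simp [State.init] at hx
  mem v x hx := by simp [State.init] at hx
  label_le v x hx := by simp [State.init] at hx
  inj v w x hx := by simp [State.init] at hx
  nodup := hL.1
  pending_mem x hx := (hL.2 x).1 hx
  pending_not_mem x hx v := by simp [State.init]

theorem exists_fin_ne (hd : 2 ≤ d) (j : Fin d) : ∃ j' : Fin d, j' ≠ j := by
  have : Nontrivial (Fin d) := Fin.nontrivial_iff_two_le.2 hd
  exact exists_ne j

/-- The old label is a minimum over all cells of `x`, the new one is 1 plus a minimum over the
others. With `2 ≤ d` the latter minimum is over a nonempty set, so `sInf` does not take its default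
value 0. -/
theorem State.label_lt_move (hd : 2 ≤ d) {h : Fin d → U → Fin m} {s : State U d m} {x : U}
    {rest : List U} {j : Fin d} (hj : IsArgmin h s x j) :
    s.label (j, h j x) < (s.move h x rest j).label (j, h j x) := by
  obtain ⟨j', hj'⟩ := exists_fin_ne hd j
  have hne : {k : ℕ | ∃ j' : Fin d, j' ≠ j ∧ k = s.label (j', h j' x)}.Nonempty :=
    ⟨_, j', hj', rfl⟩
  obtain ⟨j'', -, h2⟩ := Nat.sInf_mem hne
  simp only [State.move, Function.update_self]
  rw [h2]
  exact Nat.lt_succ_of_le (hj j'')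

theorem State.label_le_move (hd : 2 ≤ d) {h : Fin d → U → Fin m} {s : State U d m} {x : U}
    {rest : List U} {j : Fin d} (hj : IsArgmin h s x j) (v : Fin d × Fin m) :
    s.label v ≤ (s.move h x rest j).label v := by
  by_cases hv : v = (j, h j x)
  · subst hv
    exact (State.label_lt_move hd hj).le
  · simp [State.move, Function.update_of_ne hv]

theorem Invariant.move (hd : 2 ≤ d) {h : Fin d → U → Fin m} {S : Finset U} {s : State U d m}
    (hs : Invariant h S s) {x : U} {rest : List U} {j : Fin d} (hp : s.pending = x :: rest)
    (hj : IsArgmin h s x j) : Invariant h S (s.move h x rest j) := by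
  have hxS : x ∈ S := hs.pending_mem x (by simp [hp])
  have hxT : ∀ v, s.table v ≠ some x := hs.pending_not_mem x (by simp [hp])
  have hnd : x ∉ rest ∧ rest.Nodup := by
    have := hs.nodup
    rwa [hp, List.nodup_cons] at this
  have htab : ∀ v y, (s.move h x rest j).table v = some y →
      (v = (j, h j x) ∧ y = x) ∨ (v ≠ (j, h j x) ∧ s.table v = some y) := by
    intro v y hv
    by_cases hvj : v = (j, h j x)
    · left
      subst hvj
      simp only [State.move, Function.update_self, Option.some.injEq] at hv
      exact ⟨rfl, hv.symm⟩
    · right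
      simp only [State.move, Function.update_of_ne hvj] at hv
      exact ⟨hvj, hv⟩
  have hpend : (s.move h x rest j).pending = rest ∨
      ∃ y, s.table (j, h j x) = some y ∧ (s.move h x rest j).pending = y :: rest := by
    cases hc : s.table (j, h j x) with
    | none => left; simp [State.move, hc]
    | some y => right; exact ⟨y, rfl, by simp [State.move, hc]⟩
  have hrest : ∀ y ∈ rest, y ∈ S ∧ y ≠ x ∧ ∀ v, s.table v ≠ some y := fun y hy =>
    ⟨hs.pending_mem y (by simp [hp, hy]), fun e => hnd.1 (e ▸ hy),
      hs.pending_not_mem y (by simp [hp, hy])⟩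
  have hout : ∀ y, s.table (j, h j x) = some y →
      ∀ v, (s.move h x rest j).table v ≠ some y := by
    intro y hy v hv
    rcases htab v y hv with ⟨-, rfl⟩ | ⟨hne, hv'⟩
    · exact hxT _ hy
    · exact hne (hs.inj _ _ _ hv' hy)
  have hrest' : ∀ y ∈ rest, ∀ v, (s.move h x rest j).table v ≠ some y := by
    intro y hy v hv
    rcases htab v y hv with ⟨-, rfl⟩ | ⟨-, hv'⟩
    · exact (hrest y hy).2.1 rfl
    · exact (hrest y hy).2.2 _ hv'
  refine ⟨?_, ?_, ?_, ?_, ?_, ?_, ?_, ?_⟩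
  · intro v hv
    have hvj : v ≠ (j, h j x) := by
      rintro rfl
      simp [State.move] at hv
    simp only [State.move, Function.update_of_ne hvj] at hv ⊢
    exact hs.free v hv
  · intro v y hv
    rcases htab v y hv with ⟨rfl, rfl⟩ | ⟨-, hv'⟩
    · rfl
    · exact hs.cell v y hv'
  · intro v y hv
    rcases htab v y hv with ⟨rfl, rfl⟩ | ⟨-, hv'⟩
    · exact hxS
    · exact hs.mem v y hv'
  · intro v y hv k hk
    rcases htab v y hv with ⟨rfl, rfl⟩ | ⟨hne, hv'⟩
    · have hk' : (k, h k y) ≠ (j, h j y) := fun e => hk (congrArg Prod.fst e)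
      simp only [State.move, Function.update_self, Function.update_of_ne hk']
      exact Nat.succ_le_succ (Nat.sInf_le ⟨k, hk, rfl⟩)
    -- For a key not moved, its own label is unchanged and the labels of its alternatives can only
    -- have grown.
    · have h1 : (s.move h x rest j).label v = s.label v := by
        simp [State.move, Function.update_of_ne hne]
      rw [h1]
      exact (hs.label_le v y hv' k hk).trans
        (Nat.succ_le_succ (State.label_le_move hd hj _))
  · intro v w y hv hw
    rcases htab v y hv with ⟨rfl, rfl⟩ | ⟨-, hv'⟩
    · rcases htab w y hw with ⟨rfl, -⟩ | ⟨-, hw'⟩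
      · rfl
      · exact absurd hw' (hxT _)
    · rcases htab w y hw with ⟨-, rfl⟩ | ⟨-, hw'⟩
      · exact absurd hv' (hxT _)
      · exact hs.inj _ _ _ hv' hw'
  · rcases hpend with e | ⟨y, hy, e⟩
    · rw [e]; exact hnd.2
    · rw [e, List.nodup_cons]
      exact ⟨fun hmem => (hrest y hmem).2.2 _ hy, hnd.2⟩
  · rcases hpend with e | ⟨y, hy, e⟩
    · rw [e]; exact fun z hz => (hrest z hz).1
    · rw [e]
      intro z hz
      rcases List.mem_cons.1 hz with rfl | hz
      · exact hs.mem _ _ hy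
      · exact (hrest z hz).1
  · rcases hpend with e | ⟨y, hy, e⟩
    · rw [e]; exact hrest'
    · rw [e]
      intro z hz
      rcases List.mem_cons.1 hz with rfl | hz
      · exact hout _ hy
      · exact hrest' z hz

theorem Invariant.of_reachable (hd : 2 ≤ d) {h : Fin d → U → Fin m} {S : Finset U} {L : List U}
    (hL : IsOrdering S L) {n : ℕ} {s : State U d m} (hs : Reachable h n L s) :
    Invariant h S s := by
  induction hs with
  | refl => exact Invariant.init h S hL
  | tail _ hst ih =>
    obtain ⟨-, x, rest, j, hp, hj, rfl⟩ := hst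
    exact ih.move hd hp hj

/-- A path of occupied cells from a cell with large label either can be prolonged or yields a
closed path of keys. -/
theorem Invariant.exists_cells (hd : 3 ≤ d) {h : Fin d → U → Fin m} {S : Finset U}
    {s : State U d m} (hs : Invariant h S s) {t : ℕ} {v₀ : Fin d × Fin m}
    (hv₀ : t < s.label v₀) (hno : ∀ r ≤ t, ¬ HasClosedPath h S r) (r : ℕ) (hr : r ≤ t) :
    ∃ (v : ℕ → Fin d × Fin m) (x : ℕ → U), (∀ i ≤ r, s.table (v i) = some (x i)) ∧
      (∀ i ≤ r, ∀ i' ≤ r, v i = v i' → i = i') ∧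
      (∀ i < r, (v (i + 1)).1 ≠ (v i).1 ∧ (v (i + 1)).2 = h (v (i + 1)).1 (x i)) ∧
      t < s.label (v r) + r := by
  have hocc : ∀ v, 0 < s.label v → ∃ x, s.table v = some x := by
    intro v hv
    cases hc : s.table v with
    | none => rw [hs.free v hc] at hv; omega
    | some x => exact ⟨x, rfl⟩
  induction r with
  | zero =>
    obtain ⟨x, hx⟩ := hocc v₀ (by omega)
    refine ⟨fun _ => v₀, fun _ => x, fun _ _ => hx, fun i hi i' hi' _ => by omega,
      fun i hi => by omega, by simpa using hv₀⟩
  | succ r ih =>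
    obtain ⟨v, x, htab, hinj, hlink, hlab⟩ := ih (by omega)
    -- Either the last key has an alternative cell that is new to the path, or all its alternatives
    -- were visited.
    by_cases hex : ∃ k, k ≠ (v r).1 ∧ ∀ i ≤ r, v i ≠ (k, h k (x r))
    · obtain ⟨k, hk, hnew⟩ := hex
      have hl := hs.label_le _ _ (htab r le_rfl) k hk
      obtain ⟨y, hy⟩ := hocc (k, h k (x r)) (by omega)
      refine ⟨fun i => if i ≤ r then v i else (k, h k (x r)),
        fun i => if i ≤ r then x i else y, ?_, ?_, ?_, ?_⟩
      · intro i hi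
        by_cases hir : i ≤ r
        · simpa [hir] using htab i hir
        · simpa [hir] using hy
      · intro i hi i' hi' he
        by_cases hir : i ≤ r <;> by_cases hir' : i' ≤ r <;> simp only [hir, hir', if_true, if_false] at he
        · exact hinj i hir i' hir' he
        · exact absurd he (hnew i hir)
        · exact absurd he.symm (hnew i' hir')
        · omega
      · intro i hi
        by_cases hir : i < r
        · have h1 : i + 1 ≤ r := hir
          have h2 : i ≤ r := hir.le
          simpa only [h1, h2, if_true] using hlink i hir
        · have h3 : i = r := by omega
          subst h3
          simpa using hk
      · simp
        omega
    · exfalso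
      push Not at hex
      have hcell : ∀ i ≤ r, (v i).2 = h (v i).1 (x i) := fun i hi => hs.cell _ _ (htab i hi)
      obtain ⟨k, hk, k', hk', hkk⟩ : ∃ k, k ≠ (v r).1 ∧ ∃ k', k' ≠ (v r).1 ∧ k ≠ k' := by
        have hcard : 1 < (Finset.univ.erase (v r).1).card := by
          rw [Finset.card_erase_of_mem (Finset.mem_univ _), Finset.card_univ, Fintype.card_fin]
          omega
        obtain ⟨k, hk, k', hk', hne⟩ := Finset.one_lt_card.1 hcard
        exact ⟨k, Finset.ne_of_mem_erase hk, k', Finset.ne_of_mem_erase hk', hne⟩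
      -- A visited alternative cell is held by an earlier key `x a`, which therefore hashes to it as
      -- well.
      have key : ∀ k, k ≠ (v r).1 → ∃ a : Fin r, h k (x r) = h k (x a) := by
        intro k hk
        obtain ⟨a, ha, hva⟩ := hex k hk
        have har : a ≠ r := by
          rintro rfl
          exact hk (by rw [hva])
        refine ⟨⟨a, by omega⟩, ?_⟩
        have := hcell a ha
        rw [hva] at this
        exact this
      obtain ⟨a, ha⟩ := key k hk
      obtain ⟨b, hb⟩ := key k' hk'
      refine hno r (by omega) ⟨fun i => x i, fun i => (v i).1, ?_, ?_, ?_, ?_, a, b, k, k', hkk,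
        by simpa using hk, by simpa using hk', by simpa using ha, by simpa using hb⟩
      · intro i i' he
        have h1 := htab i (by omega)
        have h2 := htab i' (by omega)
        simp only at he
        rw [← he] at h2
        exact Fin.ext (hinj i (by omega) i' (by omega) (hs.inj _ _ _ h1 h2))
      · exact fun i => hs.mem _ _ (htab i (by omega))
      · exact fun i => by simpa using (hlink i i.2).1
      · intro i
        have h1 := (hlink i i.2).2
        have h2 := hcell (i + 1) (by omega)
        simpa using h2.symm.trans h1

theorem Invariant.label_le_of_not_hasPath (hd : 3 ≤ d) {h : Fin d → U → Fin m} {S : Finset U}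
    {s : State U d m} (hs : Invariant h S s) {t : ℕ} (hpath : ¬ HasPath h S t)
    (hno : ∀ r ≤ t, ¬ HasClosedPath h S r) (v₀ : Fin d × Fin m) : s.label v₀ ≤ t := by
  by_contra! hlt
  obtain ⟨v, x, htab, hinj, hlink, -⟩ := hs.exists_cells hd hlt hno t le_rfl
  refine hpath ⟨fun i => x i, fun i => (v i).1, ?_, ?_, ?_, ?_⟩
  · intro i i' he
    have h1 := htab i (by omega)
    have h2 := htab i' (by omega)
    simp only at he
    rw [← he] at h2
    exact Fin.ext (hinj i (by omega) i' (by omega) (hs.inj _ _ _ h1 h2))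
  · exact fun i => hs.mem _ _ (htab i (by omega))
  · exact fun i => by simpa using (hlink i i.2).1
  · intro i
    have h1 := (hlink i i.2).2
    have h2 := hs.cell _ _ (htab (i + 1) (by omega))
    simpa using h2.symm.trans h1

theorem Step.sum_label_lt (hd : 2 ≤ d) {h : Fin d → U → Fin m} {n : ℕ} {s t : State U d m}
    (hst : Step h n s t) : ∑ v, s.label v < ∑ v, t.label v := by
  obtain ⟨-, x, rest, j, -, hj, rfl⟩ := hst
  exact Finset.sum_lt_sum (fun v _ => State.label_le_move hd hj v)
    ⟨_, Finset.mem_univ _, State.label_lt_move hd hj⟩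

/-- The sum of labels is a strictly increasing potential, and it is bounded because no move is made
once a label exceeds `n`. -/
theorem not_exists_infinite_run (hd : 2 ≤ d) (h : Fin d → U → Fin m) (n : ℕ)
    (s₀ : State U d m) :
    ¬ ∃ run : ℕ → State U d m, run 0 = s₀ ∧ ∀ k, Step h n (run k) (run (k + 1)) := by
  rintro ⟨run, -, hrun⟩
  have h1 : ∀ k, k ≤ ∑ v, (run k).label v := by
    intro k
    induction k with
    | zero => exact Nat.zero_le _
    | succ k ih => exact Nat.succ_le_of_lt (ih.trans_lt ((hrun k).sum_label_lt hd))
  have h2 : ∀ k, ∑ v, (run k).label v ≤ Fintype.card (Fin d × Fin m) * n := by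
    intro k
    have h3 := Finset.sum_le_card_nsmul Finset.univ (run k).label n
      fun v hv => (Finset.le_sup hv).trans (hrun k).1
    simpa using h3
  have := (h1 (Fintype.card (Fin d × Fin m) * n + 1)).trans (h2 _)
  omega

theorem allInsertionsSucceed_of_maxLabel_le (hd : 2 ≤ d) {h : Fin d → U → Fin m} {n : ℕ}
    {L : List U} (hlab : ∀ s, Reachable h n L s → s.maxLabel ≤ n) :
    AllInsertionsSucceed h n L := by
  refine ⟨not_exists_infinite_run hd h n _, fun s hs hstuck => ⟨?_, hlab s hs⟩⟩
  cases hp : s.pending with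
  | nil => rfl
  | cons x rest =>
    have : Nonempty (Fin d) := ⟨⟨0, by omega⟩⟩
    obtain ⟨j, hj⟩ := Finite.exists_min fun j => s.label (j, h j x)
    exact absurd ⟨hlab s hs, x, rest, j, hp, hj, rfl⟩ (hstuck _)

/-- If there are neither long paths nor short closed paths, then Khosla's algorithm succeeds, with
small labels. -/
theorem khosla_succeeds (hd : 3 ≤ d) {h : Fin d → U → Fin m} {S : Finset U} {n t : ℕ}
    (ht : t ≤ n) (hpath : ¬ HasPath h S t) (hno : ∀ r ≤ t, ¬ HasClosedPath h S r) {L : List U}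
    (hL : IsOrdering S L) :
    AllInsertionsSucceed h n L ∧ ∀ s, Reachable h n L s → s.maxLabel ≤ t := by
  have key : ∀ s : State U d m, Reachable h n L s → s.maxLabel ≤ t := fun s hs =>
    Finset.sup_le fun v _ =>
      (Invariant.of_reachable (by omega) hL hs).label_le_of_not_hasPath hd hpath hno v
  exact ⟨allInsertionsSucceed_of_maxLabel_le (by omega) fun s hs => (key s hs).trans ht, key⟩

/-! ### Full randomness of the class on good key sets -/

theorem unifProb_eq {Ω : Type*} (A : Finset Ω) (E : Ω → Prop) [DecidablePred E] :
    unifProb A E = ((A.filter E).card : ℝ) / (A.card : ℝ) := by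
  unfold unifProb
  congr!

section Randomness

variable {U : Type*} {c d ℓ m : ℕ}

/-- One component of a hash function sequence. -/
def rowHash (g : Fin c → U → Fin ℓ) (p : (U → Fin m) × (Fin c → Fin ℓ → Fin m)) (x : U) : Fin m :=
  ⟨((p.1 x : ℕ) + ∑ j : Fin c, (p.2 j (g j x) : ℕ)) % m, Nat.mod_lt _ (p.1 x).pos⟩

open Fin.CommRing in
-- Reduction mod `m` becomes addition in the ring `Fin m`, so that hash values can be translated
-- bijectively.
theorem rowHash_eq [NeZero m] (g : Fin c → U → Fin ℓ)
    (p : (U → Fin m) × (Fin c → Fin ℓ → Fin m)) (x : U) :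
    rowHash g p x = p.1 x + ∑ j, p.2 j (g j x) := by
  have h : rowHash g p x = (((p.1 x : ℕ) + ∑ j : Fin c, (p.2 j (g j x) : ℕ) : ℕ) : Fin m) :=
    Fin.ext (by rw [Fin.val_natCast]; rfl)
  rw [h, Nat.cast_add, Nat.cast_sum]
  simp only [Fin.cast_val_eq_self]

/-- Add `a` to one table entry. -/
def shiftEntry [NeZero m] (j₀ : Fin c) (e : Fin ℓ) (a : Fin m) (z : Fin c → Fin ℓ → Fin m) :
    Fin c → Fin ℓ → Fin m :=
  fun j k => z j k + if j = j₀ ∧ k = e then a else 0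

theorem rowHash_shiftEntry [NeZero m] (g : Fin c → U → Fin ℓ) (f : U → Fin m)
    (z : Fin c → Fin ℓ → Fin m) (j₀ : Fin c) (e : Fin ℓ) (a : Fin m) (x : U) :
    rowHash g (f, shiftEntry j₀ e a z) x = rowHash g (f, z) x + if g j₀ x = e then a else 0 := by
  simp only [rowHash_eq, shiftEntry, Finset.sum_add_distrib, ← add_assoc]
  congr 1
  rw [Finset.sum_eq_single j₀]
  · simp
  · intro j _ hj
    simp [hj]
  · simp

theorem shiftEntry_shiftEntry_neg [NeZero m] (j₀ : Fin c) (e : Fin ℓ) (a b : Fin m)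
    (hab : a + b = 0) (z : Fin c → Fin ℓ → Fin m) :
    shiftEntry j₀ e b (shiftEntry j₀ e a z) = z := by
  funext j k
  by_cases h : j = j₀ ∧ k = e <;> simp [shiftEntry, h, add_assoc, hab]

open Classical in
/-- The choices of one component (from the class `H`) with prescribed hash values on `T`. -/
noncomputable def rowsWith (g : Fin c → U → Fin ℓ) (H : Finset (U → Fin m)) (T : Finset U)
    (τ : U → Fin m) : Finset ((U → Fin m) × (Fin c → Fin ℓ → Fin m)) :=
  (H ×ˢ Finset.univ).filter fun p => ∀ x ∈ T, rowHash g p x = τ x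

theorem mem_rowsWith {g : Fin c → U → Fin ℓ} {H : Finset (U → Fin m)} {T : Finset U}
    {τ : U → Fin m} {p : (U → Fin m) × (Fin c → Fin ℓ → Fin m)} :
    p ∈ rowsWith g H T τ ↔ p.1 ∈ H ∧ ∀ x ∈ T, rowHash g p x = τ x := by
  simp [rowsWith]

open Classical in
-- The table entry that `y` reads through `g j₀` is read there by no key of `T`. Shifting it
-- translates the hash value of `y` and leaves those on `T` alone, so all `m` values of `y` are
-- equally frequent.
theorem card_rowsWith_insert [NeZero m] (g : Fin c → U → Fin ℓ) (H : Finset (U → Fin m))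
    (T : Finset U) (τ : U → Fin m) (j₀ : Fin c) (y : U) (hy : g j₀ y ∉ T.image (g j₀)) :
    (rowsWith g H (insert y T) τ).card * m = (rowsWith g H T τ).card := by
  have hne : ∀ x ∈ T, g j₀ x ≠ g j₀ y := fun x hx e =>
    hy (Finset.mem_image.2 ⟨x, hx, e⟩)
  rw [Finset.card_eq_sum_card_fiberwise (s := rowsWith g H T τ) (t := Finset.univ)
    (f := fun p => rowHash g p y) (fun _ _ => Finset.mem_coe.2 (Finset.mem_univ _))]
  rw [Finset.sum_congr rfl (g := fun _ => (rowsWith g H (insert y T) τ).card)]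
  · simp [mul_comm]
  intro b _
  refine Finset.card_nbij' (fun p => (p.1, shiftEntry j₀ (g j₀ y) (τ y - b) p.2))
    (fun p => (p.1, shiftEntry j₀ (g j₀ y) (b - τ y) p.2)) ?_ ?_ ?_ ?_
  · rintro ⟨f, z⟩ hp
    simp only [Finset.coe_filter, Set.mem_ofPred_eq, mem_rowsWith] at hp
    obtain ⟨⟨hf, hT⟩, hb⟩ := hp
    simp only [Finset.mem_coe, mem_rowsWith]
    refine ⟨hf, fun x hx => ?_⟩
    rw [rowHash_shiftEntry]
    rcases Finset.mem_insert.1 hx with rfl | hx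
    · simp [hb]
    · simp [hne x hx, hT x hx]
  · rintro ⟨f, z⟩ hp
    simp only [Finset.mem_coe, mem_rowsWith] at hp
    simp only [Finset.coe_filter, Set.mem_ofPred_eq, mem_rowsWith]
    refine ⟨⟨hp.1, fun x hx => ?_⟩, ?_⟩
    · rw [rowHash_shiftEntry]
      simp [hne x hx, hp.2 x (Finset.mem_insert_of_mem hx)]
    · rw [rowHash_shiftEntry, hp.2 y (Finset.mem_insert_self _ _)]
      simp
  · rintro ⟨f, z⟩ _
    simp only [Prod.mk.injEq, true_and]
    exact shiftEntry_shiftEntry_neg _ _ _ _ (by abel) _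
  · rintro ⟨f, z⟩ _
    simp only [Prod.mk.injEq, true_and]
    exact shiftEntry_shiftEntry_neg _ _ _ _ (by abel) _

open Classical in
theorem card_rowsWith_union [NeZero m] (g : Fin c → U → Fin ℓ) (H : Finset (U → Fin m))
    (T R : Finset U) (τ : U → Fin m) (j₀ : Fin c) (hR : Set.InjOn (g j₀) R)
    (hd : ∀ y ∈ R, g j₀ y ∉ T.image (g j₀)) :
    (rowsWith g H (T ∪ R) τ).card * m ^ R.card = (rowsWith g H T τ).card := by
  induction R using Finset.induction_on with
  | empty => simp
  | insert y R hyR ih =>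
    rw [Finset.card_insert_of_notMem hyR, pow_succ', ← mul_assoc, Finset.union_insert,
      card_rowsWith_insert g H (T ∪ R) τ j₀ y]
    · exact ih (hR.mono (by simp)) fun x hx => hd x (Finset.mem_insert_of_mem hx)
    · intro hmem
      obtain ⟨x, hx, hxy⟩ := Finset.mem_image.1 hmem
      rcases Finset.mem_union.1 hx with hx | hx
      · exact hd y (Finset.mem_insert_self _ _) (Finset.mem_image.2 ⟨x, hx, hxy⟩)
      · have := hR (by simp [hx]) (by simp) hxy
        exact hyR (this ▸ hx)

open Classical in
theorem IsTwoWiseIndependent.card_mul {H : Finset (U → Fin m)} (hH : IsTwoWiseIndependent H)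
    {x y : U} (hxy : x ≠ y) (a b : Fin m) :
    (H.filter fun f => f x = a ∧ f y = b).card * m ^ 2 = H.card := by
  have h := hH.indep x y hxy a b
  have hH0 : (H.card : ℝ) ≠ 0 := by exact_mod_cast hH.nonempty.card_pos.ne'
  have hm : (m : ℝ) ≠ 0 := by exact_mod_cast a.pos.ne'
  rw [unifProb_eq, div_eq_div_iff hH0 (pow_ne_zero 2 hm)] at h
  have h' : ((H.filter fun f => f x = a ∧ f y = b).card : ℝ) * (m : ℝ) ^ 2 = H.card := by
    rw [h, one_mul]
  exact_mod_cast h'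

open Classical in
-- For fixed tables the two conditions prescribe the values of `f` at `x` and `y`, and two-wise
-- independence applies.
theorem card_rowsWith_pair [NeZero m] (g : Fin c → U → Fin ℓ) {H : Finset (U → Fin m)}
    (hH : IsTwoWiseIndependent H) {x y : U} (hxy : x ≠ y) (τ : U → Fin m) :
    (rowsWith g H {x, y} τ).card * m ^ 2 =
      (H ×ˢ (Finset.univ : Finset (Fin c → Fin ℓ → Fin m))).card := by
  rw [Finset.card_eq_sum_card_fiberwise (s := rowsWith g H {x, y} τ) (t := Finset.univ)
    (f := fun p => p.2) (fun _ _ => Finset.mem_coe.2 (Finset.mem_univ _)), Finset.sum_mul,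
    Finset.sum_congr rfl (g := fun _ => H.card)]
  · simp [mul_comm]
  intro z _
  rw [← hH.card_mul hxy (τ x - ∑ j, z j (g j x)) (τ y - ∑ j, z j (g j y))]
  congr 1
  refine Finset.card_nbij' (fun p => p.1) (fun f => (f, z)) ?_ ?_ ?_ ?_
  · rintro ⟨f, z'⟩ hp
    simp only [Finset.coe_filter, Set.mem_ofPred_eq, mem_rowsWith] at hp
    obtain ⟨⟨hf, hT⟩, rfl⟩ := hp
    have h1 := hT x (by simp)
    have h2 := hT y (by simp)
    rw [rowHash_eq] at h1 h2
    simp only [Finset.coe_filter, Set.mem_ofPred_eq]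
    exact ⟨hf, eq_sub_of_add_eq h1, eq_sub_of_add_eq h2⟩
  · intro f hf
    simp only [Finset.coe_filter, Set.mem_ofPred_eq] at hf
    simp only [Finset.coe_filter, Set.mem_ofPred_eq, mem_rowsWith, Finset.mem_insert,
      Finset.mem_singleton, forall_eq_or_imp, forall_eq, and_true, rowHash_eq]
    exact ⟨hf.1, by rw [hf.2.1]; abel, by rw [hf.2.2]; abel⟩
  · rintro ⟨f, z'⟩ hp
    simp only [Finset.coe_filter, Set.mem_ofPred_eq] at hp
    simp [hp.2]
  · intro f _
    rfl

open Classical in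
/-- If some `g_j` is almost injective on `T`, then the hash values on `T` are fully random. -/
theorem card_rowsWith [NeZero m] (g : Fin c → U → Fin ℓ) {H : Finset (U → Fin m)}
    (hH : IsTwoWiseIndependent H) (T : Finset U) (τ : U → Fin m) (j₀ : Fin c)
    (hT : T.card ≤ (T.image (g j₀)).card + 1) :
    (rowsWith g H T τ).card * m ^ T.card =
      (H ×ˢ (Finset.univ : Finset (Fin c → Fin ℓ → Fin m))).card := by
  by_cases hinj : Set.InjOn (g j₀) T
  · have h := card_rowsWith_union g H ∅ T τ j₀ hinj (by simp)
    rw [Finset.empty_union] at h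
    rw [h]
    simp [rowsWith]
  · simp only [Set.InjOn, not_forall] at hinj
    obtain ⟨x, hx, y, hy, hg, hxy⟩ := hinj
    have hx' : x ∈ T := hx
    have hy' : y ∈ T := hy
    -- Since `x` and `y` collide, dropping `y` loses no value. By the cardinality hypothesis `g j₀`
    -- is then injective on `T.erase y`, so `x, y` is the only colliding pair.
    have himg : (T.erase y).image (g j₀) = T.image (g j₀) := by
      refine Finset.Subset.antisymm (Finset.image_subset_image (Finset.erase_subset _ _)) ?_
      intro e he
      obtain ⟨u, hu, rfl⟩ := Finset.mem_image.1 he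
      by_cases huy : u = y
      · subst huy
        exact Finset.mem_image.2 ⟨x, Finset.mem_erase.2 ⟨hxy, hx'⟩, hg⟩
      · exact Finset.mem_image_of_mem _ (Finset.mem_erase.2 ⟨huy, hu⟩)
    have hinj' : Set.InjOn (g j₀) (T.erase y) := by
      rw [← Finset.card_image_iff]
      refine le_antisymm Finset.card_image_le ?_
      rw [himg, Finset.card_erase_of_mem hy']
      omega
    have hsub : (T \ {x, y}) ⊆ T.erase y := by
      intro u hu
      simp only [Finset.mem_sdiff, Finset.mem_insert, Finset.mem_singleton, not_or] at hu
      exact Finset.mem_erase.2 ⟨hu.2.2, hu.1⟩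
    have h := card_rowsWith_union g H {x, y} (T \ {x, y}) τ j₀
      (hinj'.mono (by exact_mod_cast hsub)) ?_
    · have hpair : ({x, y} : Finset U) ⊆ T := by
        intro u hu
        rcases Finset.mem_insert.1 hu with rfl | hu
        · exact hx'
        · rw [Finset.mem_singleton.1 hu]; exact hy'
      have hcard : T.card = (T \ {x, y}).card + 2 := by
        rw [← Finset.card_sdiff_add_card_eq_card hpair, Finset.card_pair hxy]
      rw [Finset.union_sdiff_of_subset hpair] at h
      rw [hcard, pow_add, ← mul_assoc, h, card_rowsWith_pair g hH hxy τ]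
    · intro u hu hmem
      have hu' := hsub hu
      simp only [Finset.mem_sdiff, Finset.mem_insert, Finset.mem_singleton, not_or] at hu
      have hgu : g j₀ x = g j₀ u := by
        obtain ⟨v, hv, hvu⟩ := Finset.mem_image.1 hmem
        rcases Finset.mem_insert.1 hv with rfl | hv
        · exact hvu
        · rw [Finset.mem_singleton.1 hv] at hvu
          exact hg.trans hvu
      exact hu.2.1 (hinj' (Finset.mem_coe.2 (Finset.mem_erase.2 ⟨hxy, hx'⟩))
        (Finset.mem_coe.2 hu') hgu).symm

/-- The components `f` and `z` of a hash function sequence. -/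
abbrev FunTables (U : Type*) (c d ℓ m : ℕ) : Type _ :=
  (Fin d → U → Fin m) × (Fin d → Fin c → Fin ℓ → Fin m)

/-- The choices of `f` and `z`, the `f_i` taken from `H`. -/
def funTables (c d : ℕ) (ℓ : ℕ) (H : Finset (U → Fin m)) : Finset (FunTables U c d ℓ m) :=
  Fintype.piFinset (fun _ : Fin d => H) ×ˢ Finset.univ

theorem card_funTables_filter (H : Finset (U → Fin m))
    (P : Fin d → (U → Fin m) × (Fin c → Fin ℓ → Fin m) → Prop) [∀ i, DecidablePred (P i)] :
    ((funTables c d ℓ H).filter fun q => ∀ i, P i (q.1 i, q.2 i)).card =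
      ∏ i, ((H ×ˢ Finset.univ).filter (P i)).card := by
  rw [← Fintype.card_piFinset]
  refine Finset.card_nbij' (fun q i => (q.1 i, q.2 i)) (fun r => (fun i => (r i).1, fun i => (r i).2))
    ?_ ?_ ?_ ?_
  · intro q hq
    simp only [funTables, Finset.coe_filter, Finset.mem_product, Fintype.mem_piFinset,
      Finset.mem_univ, and_true, Set.mem_ofPred_eq] at hq
    simp only [Finset.mem_coe, Fintype.mem_piFinset, Finset.mem_filter, Finset.mem_product,
      Finset.mem_univ, and_true]
    exact fun i => ⟨hq.1 i, hq.2 i⟩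
  · intro r hr
    simp only [Finset.mem_coe, Fintype.mem_piFinset, Finset.mem_filter, Finset.mem_product,
      Finset.mem_univ, and_true] at hr
    simp only [funTables, Finset.coe_filter, Finset.mem_product, Fintype.mem_piFinset,
      Finset.mem_univ, and_true, Set.mem_ofPred_eq]
    exact ⟨fun i => (hr i).1, fun i => (hr i).2⟩
  · intro q _
    rfl
  · intro r _
    rfl

open Classical in
theorem card_funTables_eq_on [NeZero m] (g : Fin c → U → Fin ℓ) {H : Finset (U → Fin m)}
    (hH : IsTwoWiseIndependent H) (T : Finset U) (τ : Fin d → U → Fin m)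
    (hT : ∃ j₀, T.card ≤ (T.image (g j₀)).card + 1) :
    ((funTables c d ℓ H).filter fun q =>
      ∀ i, ∀ x ∈ T, rowHash g (q.1 i, q.2 i) x = τ i x).card * m ^ (T.card * d) =
      (funTables c d ℓ H).card := by
  obtain ⟨j₀, hj₀⟩ := hT
  have h1 := card_funTables_filter (c := c) (ℓ := ℓ) H
    (fun (i : Fin d) p => ∀ x ∈ T, rowHash g p x = τ i x)
  have h2 := card_funTables_filter (d := d) (c := c) (ℓ := ℓ) H (fun _ _ => True)
  simp only [implies_true, Finset.filter_true] at h2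
  rw [show _ = _ from h1, h2, pow_mul]
  have h3 : ((m ^ T.card) ^ d) = ∏ _i : Fin d, m ^ T.card := by simp
  rw [h3, ← Finset.prod_mul_distrib]
  exact Finset.prod_congr rfl fun i _ => card_rowsWith g hH T (τ i) j₀ hj₀

open Classical in
/-- Arrays of values in which certain entries are copies of entries with smaller index. -/
noncomputable def copyArrays {N : ℕ} (m : ℕ) (D : Finset (Fin N × Fin d))
    (p : Fin N × Fin d → Fin N) : Finset (Fin N → Fin d → Fin m) :=
  Finset.univ.filter fun σ => ∀ e ∈ D, σ e.1 e.2 = σ (p e) e.2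

open Classical in
-- Each copy refers to a smaller index, so by strong induction an array is determined by its entries
-- outside `D`.
theorem card_copyArrays_mul_le {N : ℕ} (D : Finset (Fin N × Fin d)) (p : Fin N × Fin d → Fin N)
    (hp : ∀ e ∈ D, p e < e.1) : (copyArrays m D p).card * m ^ D.card ≤ m ^ (N * d) := by
  have hinj : Set.InjOn (fun (σ : Fin N → Fin d → Fin m) (e : ↥(Dᶜ)) => σ e.1.1 e.1.2)
      (copyArrays m D p) := by
    intro σ hσ σ' hσ' he
    simp only [copyArrays, Finset.coe_filter, Finset.mem_univ, true_and, Set.mem_ofPred_eq] at hσ hσ'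
    have key : ∀ k : ℕ, ∀ i : Fin N, (i : ℕ) = k → σ i = σ' i := by
      intro k
      induction k using Nat.strong_induction_on with
      | _ k ih =>
        intro i hi
        funext j
        by_cases hD : (i, j) ∈ D
        · rw [hσ _ hD, hσ' _ hD]
          have hlt : (p (i, j) : ℕ) < i := hp _ hD
          exact congrFun (ih _ (hi ▸ hlt) _ rfl) j
        · exact congrFun he ⟨(i, j), Finset.mem_compl.2 hD⟩
    exact funext fun i => key _ i rfl
  have hcard : (copyArrays m D p).card ≤ m ^ (Dᶜ).card := by
    have := Finset.card_le_card_of_injOn (t := (Finset.univ : Finset (↥(Dᶜ) → Fin m))) _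
      (fun _ _ => Finset.mem_coe.2 (Finset.mem_univ _)) hinj
    rwa [Finset.card_univ, Fintype.card_fun, Fintype.card_fin, Fintype.card_coe] at this
  calc _ ≤ m ^ (Dᶜ).card * m ^ D.card := Nat.mul_le_mul_right _ hcard
    _ = m ^ (N * d) := by
      rw [← pow_add, Finset.card_compl_add_card]
      simp

open Classical in
-- Sum over the possible arrays of hash values: each has relative frequency `m^(-N d)`, and at most
-- `m^(N d - |D|)` of them satisfy the copy relations.
theorem card_funTables_copy_mul_le [NeZero m] (g : Fin c → U → Fin ℓ) {H : Finset (U → Fin m)}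
    (hH : IsTwoWiseIndependent H) {N : ℕ} (x : Fin N → U) (hx : x.Injective)
    (hg : ∃ j₀, N ≤ (Finset.univ.image fun i => g j₀ (x i)).card + 1)
    (D : Finset (Fin N × Fin d)) (p : Fin N × Fin d → Fin N) (hp : ∀ e ∈ D, p e < e.1) :
    ((funTables c d ℓ H).filter fun q => ∀ e ∈ D,
      rowHash g (q.1 e.2, q.2 e.2) (x e.1) = rowHash g (q.1 e.2, q.2 e.2) (x (p e))).card *
        m ^ D.card ≤ (funTables c d ℓ H).card := by
  set Q := (funTables c d ℓ H).filter fun q => ∀ e ∈ D,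
      rowHash g (q.1 e.2, q.2 e.2) (x e.1) = rowHash g (q.1 e.2, q.2 e.2) (x (p e)) with hQ
  have hTcard : (Finset.univ.image x).card = N := by
    rw [Finset.card_image_of_injective _ hx]; simp
  have hmaps : Set.MapsTo (fun (q : FunTables U c d ℓ m) (k : Fin N) (i : Fin d) =>
      rowHash g (q.1 i, q.2 i) (x k)) Q (copyArrays m D p) := by
    intro q hq
    simp only [hQ, Finset.coe_filter, Set.mem_ofPred_eq] at hq
    simp only [copyArrays, Finset.coe_filter, Finset.mem_univ, true_and, Set.mem_ofPred_eq]
    exact hq.2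
  have hfib : ∀ σ ∈ copyArrays m D p, (Q.filter fun q =>
      (fun k i => rowHash g (q.1 i, q.2 i) (x k)) = σ).card * m ^ (N * d) ≤
        (funTables c d ℓ H).card := by
    intro σ _
    -- The default 0 of the extension is immaterial, as only values at the keys `x k` are
    -- prescribed.
    have h := card_funTables_eq_on (d := d) g hH (Finset.univ.image x)
      (fun i => Function.extend x (fun k => σ k i) fun _ => 0) (by
        obtain ⟨j₀, hj₀⟩ := hg
        refine ⟨j₀, ?_⟩
        rw [hTcard, Finset.image_image]
        exact hj₀)
    rw [hTcard] at h
    rw [← h]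
    refine Nat.mul_le_mul_right _ (Finset.card_le_card ?_)
    intro q hq
    simp only [hQ, Finset.mem_filter] at hq
    refine Finset.mem_filter.2 ⟨hq.1.1, fun i y hy => ?_⟩
    obtain ⟨k, -, rfl⟩ := Finset.mem_image.1 hy
    rw [hx.extend_apply, ← hq.2]
  have hsum : Q.card * m ^ (N * d) ≤ (copyArrays m D p).card * (funTables c d ℓ H).card := by
    rw [Finset.card_eq_sum_card_fiberwise hmaps, Finset.sum_mul, ← smul_eq_mul]
    exact Finset.sum_le_card_nsmul _ _ _ hfib
  have hpos : 0 < m ^ (N * d) := pow_pos (Nat.pos_of_ne_zero (NeZero.ne m)) _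
  refine Nat.le_of_mul_le_mul_right ?_ hpos
  calc Q.card * m ^ D.card * m ^ (N * d) = Q.card * m ^ (N * d) * m ^ D.card := by ring
    _ ≤ (copyArrays m D p).card * (funTables c d ℓ H).card * m ^ D.card :=
      Nat.mul_le_mul_right _ hsum
    _ = (copyArrays m D p).card * m ^ D.card * (funTables c d ℓ H).card := by ring
    _ ≤ m ^ (N * d) * (funTables c d ℓ H).card :=
      Nat.mul_le_mul_right _ (card_copyArrays_mul_le D p hp)
    _ = _ := mul_comm _ _

/-- The event that certain hash values are copies of hash values of earlier keys. -/
def CopyEvent {N : ℕ} (h : Fin d → U → Fin m) (x : Fin N → U) (D : Finset (Fin N × Fin d))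
    (p : Fin N × Fin d → Fin N) : Prop :=
  ∀ e ∈ D, h e.2 (x e.1) = h e.2 (x (p e))

open Classical in
/-- Some `g_j` is almost injective on the keys `x`. -/
def GoodOn {N : ℕ} (g : Fin c → U → Fin ℓ) (x : Fin N → U) : Prop :=
  ∃ j₀, N ≤ (Finset.univ.image fun i => g j₀ (x i)).card + 1

open Classical in
-- Condition on `g`: for each `g` satisfying `Q` the copy event has probability at most `m^(-|D|)`.
-- Keeping `Q` general allows the collision probability to be multiplied in.
theorem unifProb_copyEvent_le [NeZero m] {F : Finset (U → Fin ℓ)} {H : Finset (U → Fin m)}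
    (hF : F.Nonempty) (hH : IsTwoWiseIndependent H) {N : ℕ} (x : Fin N → U) (hx : x.Injective)
    (D : Finset (Fin N × Fin d)) (p : Fin N × Fin d → Fin N) (hp : ∀ e ∈ D, p e < e.1)
    (Q : (Fin c → U → Fin ℓ) → Prop) (hQ : ∀ g, Q g → GoodOn g x) :
    unifProb (hashClass c d F H) (fun ω => Q ω.2.1 ∧ CopyEvent ω.hash x D p) ≤
      unifProb (Fintype.piFinset fun _ : Fin c => F) Q / (m : ℝ) ^ D.card := by
  set B := (hashClass c d F H).filter fun ω => Q ω.2.1 ∧ CopyEvent ω.hash x D p with hB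
  set G := (Fintype.piFinset fun _ : Fin c => F) with hG
  have hmaps : Set.MapsTo (fun ω : HashParts U c d ℓ m => ω.2.1) B (G.filter Q) := by
    intro ω hω
    simp only [hB, hashClass, Finset.coe_filter, Finset.mem_product, Set.mem_ofPred_eq] at hω
    simp only [Finset.coe_filter, Set.mem_ofPred_eq]
    exact ⟨hω.1.2.1, hω.2.1⟩
  have hfib : ∀ g ∈ G.filter Q, (B.filter fun ω => ω.2.1 = g).card * m ^ D.card ≤
      (funTables c d ℓ H).card := by
    intro g hg
    refine le_trans (Nat.mul_le_mul_right _ ?_)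
      (card_funTables_copy_mul_le g hH x hx (hQ g (Finset.mem_filter.1 hg).2) D p hp)
    refine Finset.card_le_card_of_injOn (fun ω => (ω.1, ω.2.2)) ?_ ?_
    · intro ω hω
      simp only [hB, hashClass, Finset.coe_filter, Finset.mem_product, Set.mem_ofPred_eq,
        Finset.mem_filter] at hω
      obtain ⟨⟨⟨h1, -, -⟩, -, h3⟩, rfl⟩ := hω
      simp only [funTables, Finset.coe_filter, Finset.mem_product, Finset.mem_univ, and_true,
        Set.mem_ofPred_eq]
      exact ⟨h1, h3⟩
    · rintro ⟨f, g1, z⟩ h1 ⟨f', g2, z'⟩ h2 he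
      simp only [Finset.coe_filter, Set.mem_ofPred_eq] at h1 h2
      simp only [Prod.mk.injEq] at he
      simp only [Prod.mk.injEq]
      exact ⟨he.1, h1.2.trans h2.2.symm, he.2⟩
  have hsum : B.card * m ^ D.card ≤ (G.filter Q).card * (funTables c d ℓ H).card := by
    rw [Finset.card_eq_sum_card_fiberwise hmaps, Finset.sum_mul, ← smul_eq_mul]
    exact Finset.sum_le_card_nsmul _ _ _ hfib
  have hcard : (hashClass c d F H).card = G.card * (funTables c d ℓ H).card := by
    simp only [hashClass, funTables, Finset.card_product, hG]
    ring
  have hGpos : 0 < G.card := by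
    rw [hG, Fintype.card_piFinset]
    exact Finset.prod_pos fun _ _ => hF.card_pos
  have hFpos : 0 < (funTables c d ℓ H).card := by
    rw [funTables, Finset.card_product, Fintype.card_piFinset]
    exact Nat.mul_pos (Finset.prod_pos fun _ _ => hH.nonempty.card_pos)
      (Finset.card_pos.2 ⟨fun _ _ _ => 0, Finset.mem_univ _⟩)
  have hm : 0 < m := Nat.pos_of_ne_zero (NeZero.ne m)
  have hsum' : (B.card : ℝ) * (m : ℝ) ^ D.card ≤ (G.filter Q).card * (funTables c d ℓ H).card := by
    exact_mod_cast hsum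
  rw [unifProb_eq, unifProb_eq, hcard]
  push_cast
  have h1 : (0 : ℝ) < G.card := by exact_mod_cast hGpos
  have h2 : (0 : ℝ) < (funTables c d ℓ H).card := by exact_mod_cast hFpos
  have h3 : (0 : ℝ) < (m : ℝ) ^ D.card := by positivity
  rw [div_div, div_le_div_iff₀ (by positivity) (by positivity)]
  calc (B.card : ℝ) * (G.card * (m : ℝ) ^ D.card) = B.card * (m : ℝ) ^ D.card * G.card := by ring
    _ ≤ (G.filter Q).card * (funTables c d ℓ H).card * G.card :=
      mul_le_mul_of_nonneg_right hsum' h1.le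
    _ = _ := by ring

end Randomness

/-! ### Union bounds and collision probabilities -/

section Union

variable {Ω : Type*}

theorem unifProb_nonneg (A : Finset Ω) (E : Ω → Prop) : 0 ≤ unifProb A E := by
  unfold unifProb; positivity

theorem unifProb_le_one (A : Finset Ω) (E : Ω → Prop) : unifProb A E ≤ 1 := by
  classical
  unfold unifProb
  exact div_le_one_of_le₀ (by exact_mod_cast Finset.card_filter_le _ _) (by positivity)

theorem unifProb_mono (A : Finset Ω) {E E' : Ω → Prop} (h : ∀ ω ∈ A, E ω → E' ω) :
    unifProb A E ≤ unifProb A E' := by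
  classical
  unfold unifProb
  gcongr 1
  norm_cast
  refine Finset.card_le_card fun ω hω => ?_
  rw [Finset.mem_filter] at hω ⊢
  exact ⟨hω.1, h ω hω.1 hω.2⟩

theorem unifProb_exists_le {ι : Type*} (A : Finset Ω) (I : Finset ι) (E : ι → Ω → Prop) :
    unifProb A (fun ω => ∃ i ∈ I, E i ω) ≤ ∑ i ∈ I, unifProb A (E i) := by
  classical
  unfold unifProb
  rw [← Finset.sum_div]
  gcongr 1
  norm_cast
  refine le_trans (Finset.card_le_card ?_) Finset.card_biUnion_le
  intro ω hω
  simp only [Finset.mem_filter, Finset.mem_biUnion] at hω ⊢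
  obtain ⟨hA, i, hi, hE⟩ := hω
  exact ⟨i, hi, hA, hE⟩

theorem unifProb_exists_le_card_mul {ι : Type*} (A : Finset Ω) (I : Finset ι) (E : ι → Ω → Prop)
    (b : ℝ) (hb : ∀ i ∈ I, unifProb A (E i) ≤ b) :
    unifProb A (fun ω => ∃ i ∈ I, E i ω) ≤ I.card * b := by
  refine (unifProb_exists_le A I E).trans ?_
  rw [← nsmul_eq_mul]
  exact Finset.sum_le_card_nsmul _ _ _ hb

theorem unifProb_or_le (A : Finset Ω) (E E' : Ω → Prop) :
    unifProb A (fun ω => E ω ∨ E' ω) ≤ unifProb A E + unifProb A E' := by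
  classical
  rw [unifProb_eq, unifProb_eq, unifProb_eq, ← add_div]
  gcongr 1
  norm_cast
  rw [Finset.filter_or]
  exact Finset.card_union_le _ _

theorem unifProb_not {A : Finset Ω} (hA : A.Nonempty) (E : Ω → Prop) :
    unifProb A E = 1 - unifProb A (fun ω => ¬ E ω) := by
  classical
  unfold unifProb
  have h : (A.card : ℝ) ≠ 0 := by exact_mod_cast hA.card_pos.ne'
  rw [eq_sub_iff_add_eq, ← add_div, div_eq_one_iff_eq h]
  norm_cast
  convert Finset.card_filter_add_card_filter_not (s := A) E

/-- Collisions under all of `g_1, …, g_c`. -/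
theorem unifProb_forall_not_injective_le {U : Type*} {c ℓ N : ℕ} {F : Finset (U → Fin ℓ)}
    (hF : IsTwoUniversal F) (x : Fin N → U) (hx : x.Injective) :
    unifProb (Fintype.piFinset fun _ : Fin c => F)
      (fun g => ∀ j, ¬ Function.Injective (g j ∘ x)) ≤ (2 * (N : ℝ) ^ 2 / ℓ) ^ c := by
  classical
  have hone : unifProb F (fun f => ¬ Function.Injective (f ∘ x)) ≤ 2 * (N : ℝ) ^ 2 / ℓ := by
    calc unifProb F (fun f => ¬ Function.Injective (f ∘ x))
        ≤ unifProb F (fun f => ∃ q ∈ (Finset.univ : Finset (Fin N × Fin N)).filter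
            (fun q => q.1 ≠ q.2), f (x q.1) = f (x q.2)) := by
          refine unifProb_mono _ fun f _ hf => ?_
          simp only [Function.Injective, not_forall] at hf
          obtain ⟨a, b, hab, hne⟩ := hf
          exact ⟨(a, b), by simpa using hne, hab⟩
      _ ≤ ((Finset.univ : Finset (Fin N × Fin N)).filter (fun q => q.1 ≠ q.2)).card *
            (2 / (ℓ : ℝ)) := by
          refine unifProb_exists_le_card_mul _ _ _ _ fun q hq => ?_
          exact hF.collision _ _ (hx.ne (by simpa using hq))
      _ ≤ ((N ^ 2 : ℕ) : ℝ) * (2 / (ℓ : ℝ)) := by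
          gcongr
          refine (Finset.card_filter_le _ _).trans ?_
          simp [sq]
      _ = _ := by push_cast; ring
  have hprod : unifProb (Fintype.piFinset fun _ : Fin c => F)
      (fun g => ∀ j, ¬ Function.Injective (g j ∘ x)) =
      unifProb F (fun f => ¬ Function.Injective (f ∘ x)) ^ c := by
    rw [unifProb_eq, unifProb_eq]
    have h1 : (Fintype.piFinset fun _ : Fin c => F).filter
        (fun g => ∀ j, ¬ Function.Injective (g j ∘ x)) =
        Fintype.piFinset fun _ : Fin c => F.filter fun f => ¬ Function.Injective (f ∘ x) := by
      ext g
      simp only [Finset.mem_filter, Fintype.mem_piFinset]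
      exact ⟨fun h i => ⟨h.1 i, h.2 i⟩, fun h => ⟨fun i => (h i).1, fun i => (h i).2⟩⟩
    rw [div_pow]
    congr 1
    · rw [h1, Fintype.card_piFinset]
      simp
    · simp
  rw [hprod]
  exact pow_le_pow_left₀ (unifProb_nonneg _ _) hone c

end Union

/-! ### First moment bounds for paths and closed paths -/

section Patterns

variable {U : Type*} {c d ℓ m s : ℕ}

/-- The positions of the links of a path. -/
def linkSet (j : Fin (s + 1) → Fin d) : Finset (Fin (s + 1) × Fin d) :=
  Finset.univ.image fun i : Fin s => (i.succ, j i.succ)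

/-- The preceding index (and `0` for the index `0`). -/
def prevIndex (i : Fin (s + 1)) : Fin (s + 1) := ⟨i - 1, by omega⟩

theorem prevIndex_succ (i : Fin s) : prevIndex i.succ = i.castSucc := by
  ext; simp [prevIndex]

theorem card_linkSet (j : Fin (s + 1) → Fin d) : (linkSet j).card = s := by
  rw [linkSet, Finset.card_image_of_injective]
  · simp
  · intro a b h
    exact Fin.succ_injective _ (congrArg Prod.fst h)

theorem linked_iff_copyEvent {h : Fin d → U → Fin m} {x : Fin (s + 1) → U}
    {j : Fin (s + 1) → Fin d} :
    Linked h x j ↔ CopyEvent h x (linkSet j) fun e => prevIndex e.1 := by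
  simp [Linked, CopyEvent, linkSet, prevIndex_succ]

theorem prevIndex_lt {j : Fin (s + 1) → Fin d} (e : Fin (s + 1) × Fin d) (he : e ∈ linkSet j) :
    prevIndex e.1 < e.1 := by
  obtain ⟨i, -, rfl⟩ := Finset.mem_image.1 he
  rw [prevIndex_succ]
  exact Fin.castSucc_lt_succ

theorem unifProb_linked_le [NeZero m] {F : Finset (U → Fin ℓ)} {H : Finset (U → Fin m)}
    (hF : F.Nonempty) (hH : IsTwoWiseIndependent H) {x : Fin (s + 1) → U} (hx : x.Injective)
    (j : Fin (s + 1) → Fin d) (Q : (Fin c → U → Fin ℓ) → Prop) (hQ : ∀ g, Q g → GoodOn g x) :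
    unifProb (hashClass c d F H) (fun ω => Q ω.2.1 ∧ Linked ω.hash x j) ≤
      unifProb (Fintype.piFinset fun _ : Fin c => F) Q / (m : ℝ) ^ s := by
  have h := unifProb_copyEvent_le hF hH x hx (linkSet j) (fun e => prevIndex e.1) prevIndex_lt Q hQ
  rw [card_linkSet] at h
  exact (unifProb_mono _ fun ω _ hω => ⟨hω.1, linked_iff_copyEvent.1 hω.2⟩).trans h

theorem unifProb_closesUp_le [NeZero m] {F : Finset (U → Fin ℓ)} {H : Finset (U → Fin m)}
    (hF : F.Nonempty) (hH : IsTwoWiseIndependent H) {x : Fin (s + 1) → U} (hx : x.Injective)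
    (j : Fin (s + 1) → Fin d) (a b : Fin s) (k k' : Fin d) :
    unifProb (hashClass c d F H)
      (fun ω => GoodOn ω.2.1 x ∧ Linked ω.hash x j ∧ ClosesUp ω.hash x j a b k k') ≤
      1 / (m : ℝ) ^ (s + 2) := by
  classical
  by_cases hk : k ≠ k' ∧ k ≠ j (Fin.last s) ∧ k' ≠ j (Fin.last s)
  · obtain ⟨hkk, hk, hk'⟩ := hk
    have hmem : ∀ i : Fin d, i ≠ j (Fin.last s) → (Fin.last s, i) ∉ linkSet j := by
      intro i hi hmem
      obtain ⟨i', -, he⟩ := Finset.mem_image.1 hmem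
      simp only [Prod.mk.injEq] at he
      rw [he.1] at he
      exact hi he.2.symm
    -- The tables `k`, `k'` and `j (Fin.last s)` are distinct, so both closures are new entries in
    -- the last row: `s + 2` relations in total.
    set D := insert (Fin.last s, k) (insert (Fin.last s, k') (linkSet j)) with hD
    set p : Fin (s + 1) × Fin d → Fin (s + 1) := fun e =>
      if e = (Fin.last s, k) then a.castSucc else
        if e = (Fin.last s, k') then b.castSucc else prevIndex e.1 with hp
    have hcard : D.card = s + 2 := by
      rw [hD, Finset.card_insert_of_notMem, Finset.card_insert_of_notMem (hmem k' hk'),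
        card_linkSet]
      simp [hkk, hmem k hk]
    have hlt : ∀ e ∈ D, p e < e.1 := by
      intro e he
      simp only [hp]
      split_ifs with h1 h2
      · rw [h1]; exact Fin.castSucc_lt_last _
      · rw [h2]; exact Fin.castSucc_lt_last _
      · simp only [hD, Finset.mem_insert, h1, h2, false_or] at he
        exact prevIndex_lt e he
    have h := unifProb_copyEvent_le (c := c) hF hH x hx D p hlt (fun g => GoodOn g x) fun _ => id
    rw [hcard] at h
    refine (unifProb_mono _ fun ω _ hω => ⟨hω.1, ?_⟩).trans
      (h.trans (div_le_div_of_nonneg_right (unifProb_le_one _ _) (by positivity)))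
    obtain ⟨-, hl, -, -, -, ha, hb⟩ := hω
    intro e he
    simp only [hp]
    split_ifs with h1 h2
    · rw [h1]; exact ha
    · rw [h2]; exact hb
    · simp only [hD, Finset.mem_insert, h1, h2, false_or] at he
      exact linked_iff_copyEvent.1 hl e he
  · have h0 : unifProb (hashClass c d F H)
        (fun ω => GoodOn ω.2.1 x ∧ Linked ω.hash x j ∧ ClosesUp ω.hash x j a b k k') = 0 := by
      rw [unifProb_eq, Finset.filter_false_of_mem]
      · simp
      · rintro ω - ⟨-, -, h1, h2, h3, -⟩
        exact hk ⟨h1, h2, h3⟩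
    rw [h0]
    positivity

open Classical in
/-- The sequences of `s + 1` distinct keys from `S`. -/
noncomputable def keySeqs (S : Finset U) (s : ℕ) : Finset (Fin (s + 1) → U) :=
  (Fintype.piFinset fun _ => S).filter Function.Injective

theorem mem_keySeqs {S : Finset U} {x : Fin (s + 1) → U} :
    x ∈ keySeqs S s ↔ (∀ i, x i ∈ S) ∧ x.Injective := by
  simp [keySeqs]

theorem card_keySeqs_le (S : Finset U) (s : ℕ) : (keySeqs S s).card ≤ S.card ^ (s + 1) := by
  classical
  refine (Finset.card_filter_le _ _).trans ?_
  simp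

open Classical in
/-- The alternating sequences of table indices. -/
noncomputable def tableSeqs (d s : ℕ) : Finset (Fin (s + 1) → Fin d) :=
  Finset.univ.filter Alternating

theorem mem_tableSeqs {j : Fin (s + 1) → Fin d} : j ∈ tableSeqs d s ↔ Alternating j := by
  simp [tableSeqs]

/-- An alternating sequence is encoded by its first term and its successive differences, which are
nonzero. -/
theorem card_tableSeqs_le (d s : ℕ) [NeZero d] : (tableSeqs d s).card ≤ d * (d - 1) ^ s := by
  classical
  have h := Finset.card_le_card_of_injOn (s := tableSeqs d s)
    (t := Finset.univ ×ˢ Fintype.piFinset fun _ : Fin s => (Finset.univ.erase (0 : Fin d)))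
    (fun j => (j 0, fun i : Fin s => j i.succ - j i.castSucc)) ?_ ?_
  · simpa using h
  · intro j hj
    have hj' := mem_tableSeqs.1 hj
    simp only [Finset.mem_coe, Finset.mem_product, Finset.mem_univ, true_and,
      Fintype.mem_piFinset, Finset.mem_erase, and_true]
    exact fun i => sub_ne_zero.2 (hj' i)
  · intro j _ j' _ he
    simp only [Prod.mk.injEq] at he
    funext i
    induction i using Fin.induction with
    | zero => exact he.1
    | succ i ih =>
      have h1 := congrFun he.2 i
      simp only [ih] at h1
      exact sub_left_injective h1

/-- Delete last keys until the path becomes good. If some `g_i` were injective on the prefix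
reached, restoring one key would lose at most one value, and the longer path would have been good
already. -/
theorem exists_critical_path (hc : 0 < c) (g : Fin c → U → Fin ℓ) (h : Fin d → U → Fin m)
    (S : Finset U) (s : ℕ) (x : Fin (s + 1) → U) (j : Fin (s + 1) → Fin d)
    (hx : x ∈ keySeqs S s) (hj : j ∈ tableSeqs d s) (hl : Linked h x j) (hg : ¬ GoodOn g x) :
    ∃ r < s, ∃ x ∈ keySeqs S r, ∃ j ∈ tableSeqs d r,
      (GoodOn g x ∧ ∀ i, ¬ Function.Injective (g i ∘ x)) ∧ Linked h x j := by
  classical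
  induction s with
  -- A single key is always good; `0 < c` supplies an index.
  | zero => exact absurd ⟨⟨0, hc⟩, by simp⟩ hg
  | succ s ih =>
    have hx' : x ∘ Fin.castSucc ∈ keySeqs S s := by
      rw [mem_keySeqs] at hx ⊢
      exact ⟨fun i => hx.1 _, hx.2.comp (Fin.castSucc_injective _)⟩
    have hj' : j ∘ Fin.castSucc ∈ tableSeqs d s := by
      rw [mem_tableSeqs] at hj ⊢
      exact fun i => hj i.castSucc
    have hl' : Linked h (x ∘ Fin.castSucc) (j ∘ Fin.castSucc) := fun i => hl i.castSucc
    by_cases hg' : GoodOn g (x ∘ Fin.castSucc)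
    · refine ⟨s, Nat.lt_succ_self s, _, hx', _, hj', ⟨hg', fun i hi => hg ⟨i, ?_⟩⟩, hl'⟩
      have h1 : (Finset.univ.image fun k => g i ((x ∘ Fin.castSucc) k)).card = s + 1 := by
        exact (Finset.card_image_of_injective _ hi).trans (by simp)
      have h2 : (Finset.univ.image fun k => g i ((x ∘ Fin.castSucc) k)) ⊆
          Finset.univ.image fun k => g i (x k) := by
        intro e he
        obtain ⟨k, -, rfl⟩ := Finset.mem_image.1 he
        exact Finset.mem_image.2 ⟨k.castSucc, Finset.mem_univ _, rfl⟩
      have h3 := Finset.card_le_card h2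
      omega
    · obtain ⟨r, hr, hrest⟩ := ih _ _ hx' hj' hl' hg'
      exact ⟨r, hr.trans (Nat.lt_succ_self s), hrest⟩

/-- Either there is a long path, or a short closed path. -/
def Obstructed (h : Fin d → U → Fin m) (S : Finset U) (t : ℕ) : Prop :=
  HasPath h S t ∨ ∃ r ≤ t, HasClosedPath h S r

theorem unifProb_exists_seqs_le {Ω : Type*} [NeZero d] (A : Finset Ω) (S : Finset U)
    (E : (Fin (s + 1) → U) → (Fin (s + 1) → Fin d) → Ω → Prop) (b : ℝ)
    (hb : ∀ x ∈ keySeqs S s, ∀ j ∈ tableSeqs d s, unifProb A (E x j) ≤ b) (hb0 : 0 ≤ b) :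
    unifProb A (fun ω => ∃ x ∈ keySeqs S s, ∃ j ∈ tableSeqs d s, E x j ω) ≤
      (S.card : ℝ) ^ (s + 1) * (d * ((d : ℝ) - 1) ^ s) * b := by
  have h1 : ((keySeqs S s).card : ℝ) ≤ (S.card : ℝ) ^ (s + 1) := by
    exact_mod_cast card_keySeqs_le S s
  have h2 : ((tableSeqs d s).card : ℝ) ≤ d * ((d : ℝ) - 1) ^ s := by
    have h3 := card_tableSeqs_le d s
    have h4 : (((d - 1 : ℕ)) : ℝ) = (d : ℝ) - 1 := by
      rw [Nat.cast_sub (Nat.pos_of_ne_zero (NeZero.ne d))]; simp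
    rw [← h4]
    exact_mod_cast h3
  refine (unifProb_exists_le_card_mul A (keySeqs S s) _ ((tableSeqs d s).card * b) fun x hx =>
    unifProb_exists_le_card_mul A (tableSeqs d s) _ b fun j hj => hb x hx j hj).trans ?_
  rw [← mul_assoc]
  gcongr

theorem unifProb_obstructed_le [NeZero m] [NeZero d] (hc : 0 < c) {F : Finset (U → Fin ℓ)}
    {H : Finset (U → Fin m)} (hF : IsTwoUniversal F) (hH : IsTwoWiseIndependent H) (S : Finset U)
    (t : ℕ) :
    unifProb (hashClass c d F H) (fun ω => Obstructed ω.hash S t) ≤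
      (S.card : ℝ) ^ (t + 1) * (d * ((d : ℝ) - 1) ^ t) * (1 / (m : ℝ) ^ t) +
      ∑ s ∈ Finset.range (t + 1), (S.card : ℝ) ^ (s + 1) * (d * ((d : ℝ) - 1) ^ s) *
        ((s : ℝ) ^ 2 * (d : ℝ) ^ 2 * (1 / (m : ℝ) ^ (s + 2))) +
      ∑ s ∈ Finset.range (t + 1), (S.card : ℝ) ^ (s + 1) * (d * ((d : ℝ) - 1) ^ s) *
        ((2 * ((s : ℝ) + 1) ^ 2 / ℓ) ^ c / (m : ℝ) ^ s) := by
  classical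
  have hcover : ∀ ω ∈ hashClass c d F H, Obstructed ω.hash S t →
      ((∃ x ∈ keySeqs S t, ∃ j ∈ tableSeqs d t, GoodOn ω.2.1 x ∧ Linked ω.hash x j) ∨
      (∃ s ∈ Finset.range (t + 1), ∃ x ∈ keySeqs S s, ∃ j ∈ tableSeqs d s,
        ∃ q ∈ (Finset.univ : Finset ((Fin s × Fin s) × (Fin d × Fin d))),
        GoodOn ω.2.1 x ∧ Linked ω.hash x j ∧
          ClosesUp ω.hash x j q.1.1 q.1.2 q.2.1 q.2.2)) ∨
      (∃ s ∈ Finset.range (t + 1), ∃ x ∈ keySeqs S s, ∃ j ∈ tableSeqs d s,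
        (GoodOn ω.2.1 x ∧ ∀ i, ¬ Function.Injective (ω.2.1 i ∘ x)) ∧ Linked ω.hash x j) := by
    rintro ω - hω
    have hbad : ∀ s ≤ t, ∀ x ∈ keySeqs S s, ∀ j ∈ tableSeqs d s, Linked ω.hash x j →
        ¬ GoodOn ω.2.1 x → (∃ s ∈ Finset.range (t + 1), ∃ x ∈ keySeqs S s, ∃ j ∈ tableSeqs d s,
        (GoodOn ω.2.1 x ∧ ∀ i, ¬ Function.Injective (ω.2.1 i ∘ x)) ∧ Linked ω.hash x j) := by
      intro s hs x hx j hj hl hg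
      obtain ⟨r, hr, hrest⟩ := exists_critical_path hc ω.2.1 ω.hash S s x j hx hj hl hg
      exact ⟨r, Finset.mem_range.2 (by omega), hrest⟩
    rcases hω with ⟨x, j, hxi, hxS, hj, hl⟩ | ⟨r, hr, x, j, hxi, hxS, hj, hl, a, b, k, k', hcl⟩
    · have hx : x ∈ keySeqs S t := mem_keySeqs.2 ⟨hxS, hxi⟩
      by_cases hg : GoodOn ω.2.1 x
      · exact Or.inl (Or.inl ⟨x, hx, j, mem_tableSeqs.2 hj, hg, hl⟩)
      · exact Or.inr (hbad t le_rfl x hx j (mem_tableSeqs.2 hj) hl hg)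
    · have hx : x ∈ keySeqs S r := mem_keySeqs.2 ⟨hxS, hxi⟩
      by_cases hg : GoodOn ω.2.1 x
      · exact Or.inl (Or.inr ⟨r, Finset.mem_range.2 (by omega), x, hx, j, mem_tableSeqs.2 hj,
          ((a, b), (k, k')), Finset.mem_univ _, hg, hl, hcl⟩)
      · exact Or.inr (hbad r hr x hx j (mem_tableSeqs.2 hj) hl hg)
  refine (unifProb_mono _ hcover).trans ((unifProb_or_le _ _ _).trans
    (add_le_add ((unifProb_or_le _ _ _).trans (add_le_add ?_ ?_)) ?_))
  · refine unifProb_exists_seqs_le _ S _ _ (fun x hx j hj => ?_) (by positivity)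
    exact (unifProb_linked_le hF.nonempty hH (mem_keySeqs.1 hx).2 j (fun g => GoodOn g x)
      fun _ => id).trans (div_le_div_of_nonneg_right (unifProb_le_one _ _) (by positivity))
  · refine (unifProb_exists_le _ _ _).trans (Finset.sum_le_sum fun s _ => ?_)
    refine unifProb_exists_seqs_le _ S _ _ (fun x hx j hj => ?_) (by positivity)
    refine (unifProb_exists_le_card_mul _ _ _ (1 / (m : ℝ) ^ (s + 2)) fun q _ =>
      unifProb_closesUp_le hF.nonempty hH (mem_keySeqs.1 hx).2 j _ _ _ _).trans (le_of_eq ?_)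
    simp only [Finset.card_univ, Fintype.card_prod, Fintype.card_fin]
    push_cast
    ring
  · refine (unifProb_exists_le _ _ _).trans (Finset.sum_le_sum fun s _ => ?_)
    refine unifProb_exists_seqs_le _ S _ _ (fun x hx j hj => ?_) (by positivity)
    have hxi := (mem_keySeqs.1 hx).2
    refine (unifProb_linked_le hF.nonempty hH hxi j
      (fun g => GoodOn g x ∧ ∀ i, ¬ Function.Injective (g i ∘ x)) fun _ h => h.1).trans
      (div_le_div_of_nonneg_right ?_ (by positivity))
    refine (unifProb_mono _ fun g _ h => h.2).trans
      ((unifProb_forall_not_injective_le hF x hxi).trans (le_of_eq ?_))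
    push_cast
    rfl

end Patterns

/-! ### Numerical estimates -/

section Estimates

theorem exists_sum_pow_mul_geometric_le (k : ℕ) {ρ : ℝ} (h0 : 0 < ρ) (h1 : ρ < 1) :
    ∃ M, 0 ≤ M ∧ ∀ t, ∑ s ∈ Finset.range t, ((s : ℝ) + 1) ^ k * ρ ^ s ≤ M := by
  have hs : Summable fun s : ℕ => ((s : ℝ) + 1) ^ k * ρ ^ s := by
    have h := summable_pow_mul_geometric_of_norm_lt_one k
      (show ‖ρ‖ < 1 by rwa [Real.norm_of_nonneg h0.le])
    have h' := ((summable_nat_add_iff 1).2 h).mul_left ρ⁻¹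
    refine h'.congr fun s => ?_
    rw [pow_succ ρ s]
    push_cast
    field_simp
  exact ⟨∑' s : ℕ, ((s : ℝ) + 1) ^ k * ρ ^ s, tsum_nonneg fun s => by positivity,
    fun t => hs.sum_le_tsum _ fun s _ => by positivity⟩

/-- Rounding down at most halves a number that is at least 1. -/
theorem half_rpow_le {n ℓ : ℕ} {δ : ℝ} (hn : 1 ≤ n) (hδ : 0 < δ)
    (hℓ : ℓ = ⌊(n : ℝ) ^ δ⌋₊ ∨ ℓ = ⌈(n : ℝ) ^ δ⌉₊) : (n : ℝ) ^ δ / 2 ≤ ℓ := by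
  have h1 : 1 ≤ (n : ℝ) ^ δ := Real.one_le_rpow (by exact_mod_cast hn) hδ.le
  rcases hℓ with rfl | rfl
  · have h2 := Nat.lt_floor_add_one ((n : ℝ) ^ δ)
    have h3 : (1 : ℝ) ≤ (⌊(n : ℝ) ^ δ⌋₊ : ℝ) := by exact_mod_cast Nat.le_floor (by simpa using h1)
    linarith
  · have := Nat.le_ceil ((n : ℝ) ^ δ)
    linarith

theorem sq_le_two_pow_mul_pow {n ℓ c : ℕ} {δ : ℝ} (hn : 1 ≤ n) (hδ : 0 < δ)
    (hℓ : ℓ = ⌊(n : ℝ) ^ δ⌋₊ ∨ ℓ = ⌈(n : ℝ) ^ δ⌉₊) (hc : 2 / δ ≤ (c : ℝ)) :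
    (n : ℝ) ^ 2 ≤ 2 ^ c * (ℓ : ℝ) ^ c := by
  have h1 := half_rpow_le hn hδ hℓ
  have h2 : 2 ≤ δ * c := by rwa [div_le_iff₀' hδ] at hc
  calc (n : ℝ) ^ 2 = (n : ℝ) ^ (2 : ℝ) := by norm_cast
    _ ≤ (n : ℝ) ^ (δ * c) := Real.rpow_le_rpow_of_exponent_le (by exact_mod_cast hn) h2
    _ = ((n : ℝ) ^ δ) ^ c := by rw [Real.rpow_mul (by positivity), Real.rpow_natCast]
    _ ≤ (2 * ℓ) ^ c := pow_le_pow_left₀ (by positivity) (by linarith) c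
    _ = _ := mul_pow _ _ _

/-- The three error terms are `O(1 / n)`. -/
theorem error_terms_le {ρ q n m ℓ d M₁ M₂ : ℝ} {c t : ℕ} (hn : 1 ≤ n) (hnm : n ≤ m) (hℓ : 0 < ℓ)
    (hd : 1 ≤ d) (hq : q = (d - 1) * n / m) (hqρ : q ≤ ρ) (hρt : ρ ^ t ≤ 1 / n ^ 2)
    (hnℓ : n ^ 2 ≤ 2 ^ c * ℓ ^ c)
    (hM₁ : ∑ s ∈ Finset.range (t + 1), ((s : ℝ) + 1) ^ 2 * ρ ^ s ≤ M₁)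
    (hM₂ : ∑ s ∈ Finset.range (t + 1), ((s : ℝ) + 1) ^ (2 * c) * ρ ^ s ≤ M₂) :
    n ^ (t + 1) * (d * (d - 1) ^ t) * (1 / m ^ t) +
      ∑ s ∈ Finset.range (t + 1), n ^ (s + 1) * (d * (d - 1) ^ s) *
        ((s : ℝ) ^ 2 * d ^ 2 * (1 / m ^ (s + 2))) +
      ∑ s ∈ Finset.range (t + 1), n ^ (s + 1) * (d * (d - 1) ^ s) *
        ((2 * ((s : ℝ) + 1) ^ 2 / ℓ) ^ c / m ^ s) ≤
      (d + d ^ 3 * M₁ + d * 4 ^ c * M₂) / n := by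
  have hn0 : 0 < n := by linarith
  have hm0 : 0 < m := by linarith
  have hq0 : 0 ≤ q := by
    rw [hq]; exact div_nonneg (mul_nonneg (by linarith) hn0.le) hm0.le
  have hqs : ∀ s : ℕ, (d - 1) ^ s * n ^ s / m ^ s = q ^ s := fun s => by
    rw [hq, div_pow, mul_pow]
  -- A path has one more key than links, which leaves a factor `n`; this is why `ρ ^ t` must be as
  -- small as `1 / n ^ 2`.
  have hA : n ^ (t + 1) * (d * (d - 1) ^ t) * (1 / m ^ t) ≤ d / n := by
    calc n ^ (t + 1) * (d * (d - 1) ^ t) * (1 / m ^ t)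
        = d * n * ((d - 1) ^ t * n ^ t / m ^ t) := by ring
      _ ≤ d * n * (1 / n ^ 2) := by
        rw [hqs]
        exact mul_le_mul_of_nonneg_left ((pow_le_pow_left₀ hq0 hqρ t).trans hρt) (by positivity)
      _ = d / n := by field_simp
  have hB : ∑ s ∈ Finset.range (t + 1), n ^ (s + 1) * (d * (d - 1) ^ s) *
        ((s : ℝ) ^ 2 * d ^ 2 * (1 / m ^ (s + 2))) ≤ d ^ 3 * M₁ / n := by
    have hnm2 : n / m ^ 2 ≤ 1 / n := by
      rw [div_le_div_iff₀ (by positivity) hn0]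
      nlinarith
    calc _ ≤ ∑ s ∈ Finset.range (t + 1), d ^ 3 * (1 / n) * (((s : ℝ) + 1) ^ 2 * ρ ^ s) := by
          refine Finset.sum_le_sum fun s _ => ?_
          calc n ^ (s + 1) * (d * (d - 1) ^ s) * ((s : ℝ) ^ 2 * d ^ 2 * (1 / m ^ (s + 2)))
              = d ^ 3 * (n / m ^ 2) * ((s : ℝ) ^ 2 * ((d - 1) ^ s * n ^ s / m ^ s)) := by
                rw [pow_add m]
                field_simp
                ring
            _ ≤ _ := by
              rw [hqs]
              gcongr
              linarith
      _ = d ^ 3 * (1 / n) * ∑ s ∈ Finset.range (t + 1), (((s : ℝ) + 1) ^ 2 * ρ ^ s) := by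
          rw [Finset.mul_sum]
      _ ≤ d ^ 3 * (1 / n) * M₁ := by gcongr
      _ = _ := by ring
  have hC : ∑ s ∈ Finset.range (t + 1), n ^ (s + 1) * (d * (d - 1) ^ s) *
        ((2 * ((s : ℝ) + 1) ^ 2 / ℓ) ^ c / m ^ s) ≤ d * 4 ^ c * M₂ / n := by
    have hnℓ' : n * 2 ^ c / ℓ ^ c ≤ 4 ^ c / n := by
      rw [div_le_div_iff₀ (by positivity) hn0]
      calc n * 2 ^ c * n = 2 ^ c * n ^ 2 := by ring
        _ ≤ 2 ^ c * (2 ^ c * ℓ ^ c) := by gcongr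
        _ = (2 * 2) ^ c * ℓ ^ c := by rw [mul_pow]; ring
        _ = 4 ^ c * ℓ ^ c := by norm_num
    calc _ ≤ ∑ s ∈ Finset.range (t + 1), d * (4 ^ c / n) *
            (((s : ℝ) + 1) ^ (2 * c) * ρ ^ s) := by
          refine Finset.sum_le_sum fun s _ => ?_
          calc n ^ (s + 1) * (d * (d - 1) ^ s) * ((2 * ((s : ℝ) + 1) ^ 2 / ℓ) ^ c / m ^ s)
              = d * (n * 2 ^ c / ℓ ^ c) * (((s : ℝ) + 1) ^ (2 * c) *
                  ((d - 1) ^ s * n ^ s / m ^ s)) := by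
                rw [div_pow, mul_pow, ← pow_mul]
                ring
            _ ≤ _ := by
              rw [hqs]
              gcongr
      _ = d * (4 ^ c / n) * ∑ s ∈ Finset.range (t + 1), (((s : ℝ) + 1) ^ (2 * c) * ρ ^ s) := by
          rw [Finset.mul_sum]
      _ ≤ d * (4 ^ c / n) * M₂ := by gcongr
      _ = _ := by ring
  calc _ ≤ d / n + d ^ 3 * M₁ / n + d * 4 ^ c * M₂ / n := add_le_add (add_le_add hA hB) hC
    _ = _ := by ring

theorem exists_log_le (K : ℝ) : ∃ n₀ : ℕ, ∀ n : ℕ, n₀ ≤ n → K * Real.log n ≤ n := by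
  have h := (Real.isLittleO_log_id_atTop.const_mul_left K).bound one_pos
  have h' := tendsto_natCast_atTop_atTop.eventually h
  obtain ⟨n₀, hn₀⟩ := Filter.eventually_atTop.1 h'
  refine ⟨n₀, fun n hn => ?_⟩
  have := hn₀ n hn
  simp only [one_mul, id_eq, Real.norm_natCast] at this
  exact (le_abs_self _).trans this

end Estimates

end KhoslaCuckoo

/-! ### Choice of constants and conclusion -/

theorem mainTheorem9 (ε δ : ℝ) (hε : 0 < ε) (hδ0 : 0 < δ) (hδ1 : δ < 1)
    (d c : ℕ) (hd : 3 ≤ d) (hc : 2 / δ ≤ (c : ℝ)) :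
    ∃ C K : ℝ, ∀ (U : Type*) [Finite U] (n m ℓ : ℕ) (S : Finset U)
      (F : Finset (U → Fin ℓ)) (H : Finset (U → Fin m)),
      1 ≤ n → (1 + ε) * ((d : ℝ) - 1) * (n : ℝ) ≤ (m : ℝ) →
      (ℓ = ⌊(n : ℝ) ^ δ⌋₊ ∨ ℓ = ⌈(n : ℝ) ^ δ⌉₊) →
      S.card = n →
      KhoslaCuckoo.IsTwoUniversal F → KhoslaCuckoo.IsTwoWiseIndependent H →
      1 - C / (n : ℝ) ≤
        KhoslaCuckoo.unifProb (KhoslaCuckoo.hashClass c d F H) (fun ω =>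
          ∀ L : List U, KhoslaCuckoo.IsOrdering S L →
            KhoslaCuckoo.AllInsertionsSucceed ω.hash n L ∧
            ∀ s : KhoslaCuckoo.State U d m, KhoslaCuckoo.Reachable ω.hash n L s →
              (s.maxLabel : ℝ) ≤ K * Real.log (n : ℝ)) := by
  have hlogε : 0 < Real.log (1 + ε) := Real.log_pos (by linarith)
  have hlog2 : 0 < Real.log 2 := Real.log_pos (by norm_num)
  set ρ : ℝ := 1 / (1 + ε) with hρ
  have hρ0 : 0 < ρ := by positivity
  have hρ1 : ρ < 1 := by
    rw [hρ, div_lt_one (by linarith)]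
    linarith
  obtain ⟨M₁, hM₁0, hM₁⟩ := KhoslaCuckoo.exists_sum_pow_mul_geometric_le 2 hρ0 hρ1
  obtain ⟨M₂, hM₂0, hM₂⟩ := KhoslaCuckoo.exists_sum_pow_mul_geometric_le (2 * c) hρ0 hρ1
  -- The first summand comes from `ρ ^ t ≤ 1 / n ^ 2`; the second pays for rounding `t` up, since
  -- `log n ≥ log 2` for `n ≥ 2`.
  set K : ℝ := 2 / Real.log (1 + ε) + 1 / Real.log 2 with hK
  obtain ⟨n₀, hn₀⟩ := KhoslaCuckoo.exists_log_le K
  set C₀ : ℝ := (d : ℝ) + (d : ℝ) ^ 3 * M₁ + d * 4 ^ c * M₂ with hC₀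
  -- For `n < n₀` or `n < 2` this makes the claimed lower bound nonpositive. From `n₀` on, `t ≤ K
  -- log n ≤ n`, so labels bounded by `t` never make the algorithm give up.
  refine ⟨max C₀ (max (n₀ : ℝ) 2), K, ?_⟩
  intro U _ n m ℓ S F H hn hm hℓ hS hF hH
  have hnR : (1 : ℝ) ≤ n := by exact_mod_cast hn
  have hdR : (3 : ℝ) ≤ d := by exact_mod_cast hd
  by_cases hsmall : n < n₀ ∨ n < 2
  · refine le_trans ?_ (KhoslaCuckoo.unifProb_nonneg _ _)
    rw [sub_nonpos, one_le_div (by linarith)]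
    rcases hsmall with h | h
    · exact le_max_of_le_right (le_max_of_le_left (by exact_mod_cast h.le))
    · exact le_max_of_le_right (le_max_of_le_right (by exact_mod_cast h.le))
  · push Not at hsmall
    obtain ⟨hnn₀, hn2⟩ := hsmall
    have hnm : (n : ℝ) ≤ m := by
      refine le_trans ?_ hm
      have : (1 : ℝ) ≤ (1 + ε) * ((d : ℝ) - 1) := by nlinarith
      nlinarith
    have hmpos : 0 < m := by exact_mod_cast (show (0 : ℝ) < m by linarith)
    have : NeZero m := ⟨hmpos.ne'⟩
    have : NeZero d := ⟨by omega⟩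
    have hcpos : 0 < c := by
      have : (0 : ℝ) < c := lt_of_lt_of_le (by positivity) hc
      exact_mod_cast this
    set t : ℕ := ⌈2 * Real.log n / Real.log (1 + ε)⌉₊ with ht
    have hlogn : Real.log 2 ≤ Real.log n := Real.log_le_log (by norm_num) (by exact_mod_cast hn2)
    have htK : (t : ℝ) ≤ K * Real.log n := by
      have h1 := Nat.ceil_lt_add_one (a := 2 * Real.log n / Real.log (1 + ε))
        (div_nonneg (by linarith) hlogε.le)
      have h2 : 1 ≤ 1 / Real.log 2 * Real.log n := by
        rw [one_div, inv_mul_eq_div, one_le_div hlog2]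
        exact hlogn
      have h3 : K * Real.log n =
          2 * Real.log n / Real.log (1 + ε) + 1 / Real.log 2 * Real.log n := by
        rw [hK]; ring
      rw [h3]
      linarith
    have htn : t ≤ n := by exact_mod_cast htK.trans (hn₀ n hnn₀)
    have hρt : ρ ^ t ≤ 1 / (n : ℝ) ^ 2 := by
      have h1 : 2 * Real.log n ≤ t * Real.log (1 + ε) := by
        rw [← div_le_iff₀ hlogε]
        exact Nat.le_ceil _
      rw [hρ, one_div_pow]
      refine one_div_le_one_div_of_le (by positivity) ?_
      rw [← Real.log_le_log_iff (by positivity) (by positivity), Real.log_pow, Real.log_pow]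
      exact_mod_cast h1
    have hℓpos : (0 : ℝ) < ℓ := by
      have h1 := KhoslaCuckoo.half_rpow_le hn hδ0 hℓ
      have h2 : 0 < (n : ℝ) ^ δ := Real.rpow_pos_of_pos (by linarith) _
      linarith
    have hqρ : ((d : ℝ) - 1) * n / m ≤ ρ := by
      rw [hρ, div_le_div_iff₀ (by linarith) (by linarith)]
      linarith
    have hbad := (KhoslaCuckoo.unifProb_obstructed_le (d := d) hcpos hF hH S t).trans
      (hS ▸ KhoslaCuckoo.error_terms_le hnR hnm hℓpos (by linarith) rfl hqρ hρt
        (KhoslaCuckoo.sq_le_two_pow_mul_pow hn hδ0 hℓ hc) (hM₁ _) (hM₂ _))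
    have hne : (KhoslaCuckoo.hashClass c d F H).Nonempty :=
      Finset.Nonempty.product (Fintype.piFinset_nonempty.2 fun _ => hH.nonempty)
        (Finset.Nonempty.product (Fintype.piFinset_nonempty.2 fun _ => hF.nonempty)
          ⟨fun _ _ _ => 0, Finset.mem_univ _⟩)
    rw [KhoslaCuckoo.unifProb_not hne]
    refine sub_le_sub_left (le_trans (KhoslaCuckoo.unifProb_mono _ ?_) (hbad.trans ?_)) 1
    · intro ω _ hω
      by_contra hno
      simp only [KhoslaCuckoo.Obstructed, not_or, not_exists, not_and] at hno
      refine hω fun L hL => ?_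
      obtain ⟨h1, h2⟩ := KhoslaCuckoo.khosla_succeeds hd htn hno.1 hno.2 hL
      exact ⟨h1, fun s hs => le_trans (by exact_mod_cast h2 s hs) htK⟩
    · rw [hS]
      exact div_le_div_of_nonneg_right (le_max_left _ _) (by linarith)
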